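/- Let $\mathbb{N}=\{0,1,2,\dots\}$ and let $\# : \mathbb{N}^2 \to \mathbb{N}$ be an operation such that for all $x, y \in \mathbb{N}$: 1. $x = 0$ if and only if there is $z \in \mathbb{N}$ with $z \# z = x$ (equivalently, $z \# z = 0$ for all $z \in \mathbb{N}$); 2. $x < y$ if and only if $(x = 0 \wedge y \neq 0) \vee (x \neq 0 \wedge y \neq 0 \wedge x \# y = x)$; 3. $y \mid x$ if and only if $x = 0 \vee (x \neq 0 \wedge x \# y = 0)$. Then the first-order theory of the structure $(\mathbb{N}, \#)$ is undecidable: the set of Gödel numbers of the first-order sentences, in the language with equality and one binary function symbol, that are true in $(\mathbb{N}, \#)$ is not computable. -/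

import Mathlib

namespace HashTheory

/-- The function symbols of the language of one binary operation: a single binary symbol. -/
inductive OpFunctions : ℕ → Type
  | op : OpFunctions 2

/-- The first-order language (with equality) whose only nonlogical symbol is one
binary function symbol. -/
def opLang : FirstOrder.Language.{0, 0} := ⟨OpFunctions, fun _ => Empty⟩

/-- The structure `(ℕ, op)`: the binary function symbol is interpreted by `op`. -/
@[reducible] def opStructure (op : ℕ → ℕ → ℕ) : opLang.Structure ℕ where
  funMap := fun {_} f => match f with
    | OpFunctions.op => fun v => op (v 0) (v 1)
  RelMap := fun r _ => Empty.elim r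

/-- The first-order theory of `(ℕ, op)`: the set of all sentences true in `(ℕ, op)`. -/
def opTheory (op : ℕ → ℕ → ℕ) : opLang.Theory :=
  @FirstOrder.Language.completeTheory opLang ℕ (opStructure op)

/-- Gödel number of a term in the variables `x₀, …, xₙ₋₁`. -/
def termCode {n : ℕ} : opLang.Term (Empty ⊕ Fin n) → ℕ
  | .var (Sum.inr i) => 2 * (i : ℕ)
  | .func OpFunctions.op ts => 2 * Nat.pair (termCode (ts 0)) (termCode (ts 1)) + 1

/-- Gödel number of a formula in the free variables `x₀, …, xₙ₋₁`
(a quantifier in front of a formula in `x₀, …, xₙ` binds `xₙ`). -/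
def formulaCode : {n : ℕ} → opLang.BoundedFormula Empty n → ℕ
  | _, .falsum => 0
  | _, .equal t₁ t₂ => 3 * Nat.pair (termCode t₁) (termCode t₂) + 1
  | _, .rel r _ => Empty.elim r
  | _, .imp φ ψ => 3 * Nat.pair (formulaCode φ) (formulaCode ψ) + 2
  | _, .all φ => 3 * formulaCode φ + 3

theorem termCode_injective {n : ℕ} (s : opLang.Term (Empty ⊕ Fin n)) :
    ∀ t, termCode s = termCode t → s = t := by
  induction s with
  | var a =>
    rintro (b | ⟨f, ts⟩) h
    · obtain a | a := a
      · exact a.elim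
      obtain b | b := b
      · exact b.elim
      simp only [termCode] at h
      have hab : a = b := Fin.ext (by omega)
      rw [hab]
    · cases f
      obtain a | a := a
      · exact a.elim
      simp only [termCode] at h
      omega
  | func f ts ih =>
    cases f
    rintro (b | ⟨f, us⟩) h
    · obtain b | b := b
      · exact b.elim
      simp only [termCode] at h
      omega
    · cases f
      simp only [termCode] at h
      obtain ⟨h0, h1⟩ := Nat.pair_eq_pair.1 (Nat.eq_of_mul_eq_mul_left (by norm_num) (Nat.add_right_cancel h))
      have : ts = us := by
        funext i
        match i with
        | 0 => exact ih 0 _ h0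
        | 1 => exact ih 1 _ h1
      rw [this]

/-- Distinct formulas have distinct Gödel numbers. -/
theorem formulaCode_injective {n : ℕ} (φ : opLang.BoundedFormula Empty n) :
    ∀ ψ, formulaCode φ = formulaCode ψ → φ = ψ := by
  induction φ with
  | falsum =>
    intro ψ h
    cases ψ with
    | falsum => rfl
    | rel r _ => exact Empty.elim r
    | equal => simp only [formulaCode] at h; omega
    | imp => simp only [formulaCode] at h; omega
    | all => simp only [formulaCode] at h; omega
  | rel r _ => exact Empty.elim r
  | equal t₁ t₂ =>
    intro ψ h
    cases ψ with
    | falsum => simp only [formulaCode] at h; omega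
    | rel r _ => exact Empty.elim r
    | equal u₁ u₂ =>
      simp only [formulaCode] at h
      obtain ⟨h1, h2⟩ := Nat.pair_eq_pair.1 (Nat.eq_of_mul_eq_mul_left (by norm_num) (Nat.add_right_cancel h))
      rw [termCode_injective _ _ h1, termCode_injective _ _ h2]
    | imp => simp only [formulaCode] at h; omega
    | all => simp only [formulaCode] at h; omega
  | imp φ₁ φ₂ ih1 ih2 =>
    intro ψ h
    cases ψ with
    | falsum => simp only [formulaCode] at h; omega
    | rel r _ => exact Empty.elim r
    | equal => simp only [formulaCode] at h; omega
    | imp =>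
      simp only [formulaCode] at h
      obtain ⟨h1, h2⟩ := Nat.pair_eq_pair.1 (Nat.eq_of_mul_eq_mul_left (by norm_num) (Nat.add_right_cancel h))
      rw [ih1 _ h1, ih2 _ h2]
    | all => simp only [formulaCode] at h; omega
  | all φ ih =>
    intro ψ h
    cases ψ with
    | falsum => simp only [formulaCode] at h; omega
    | rel r _ => exact Empty.elim r
    | equal => simp only [formulaCode] at h; omega
    | imp => simp only [formulaCode] at h; omega
    | all =>
      simp only [formulaCode] at h
      rw [ih _ (Nat.eq_of_mul_eq_mul_left (by norm_num) (Nat.add_right_cancel h))]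

/-- A theory is decidable if the set of Gödel numbers of its sentences is computable. -/
def DecidableTheory (T : opLang.Theory) : Prop :=
  ComputablePred fun n : ℕ => ∃ φ : opLang.Sentence, φ ∈ T ∧ formulaCode φ = n

end HashTheory

/-!
The structure `(ℕ, #)` is undecidable because the halting problem reduces to its theory.

The hypotheses make `0`, the order and divisibility definable in `(ℕ, #)`. Order and divisibility
together define all of arithmetic. If `d` divides `n`, then `n + d` is the next multiple of `d`
after `n`. For positive `x` and `y` there is a common multiple `n` of `x` and `x + y` such that `y`
divides `n + x` (`HashTheory.exists_dvd_add`), and so `z = x + y` says that, for some such `n`,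
stepping to the next multiple of `x` and from there to the next multiple of `y` leads to the next
multiple of `z` after `n` (`HashTheory.eq_add_iff`). The square `s` of `x` is then determined by
`lcm x (x + 1) = x + s` (`HashTheory.eq_sq_iff`), and the product of `x` and `y` by
`(x + y)² = 2xy + x² + y²`.

With addition and multiplication, Gödel's `β` function is definable, and with it the graph of every
partial recursive function (`HashTheory.defPred_mem_partrec`). Hence some formula `A` with one free
variable defines the set of the programs that halt on input `0`. For every `n` the sentence
`HashTheory.memSentence A n` says that `n` satisfies `A`. Since the language has no closed terms, it
describes `n` by the existence of descending chains of length `n` below `n`, but not of length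
`n + 1`. Its Gödel number is a primitive recursive function of `n`
(`HashTheory.primrec_formulaCode_memSentence`), so a decision procedure for the theory would decide
the halting problem.
-/

namespace HashTheory

open FirstOrder FirstOrder.Language

/-! ### Definable predicates and functions -/

section Definability

variable {L : FirstOrder.Language.{0, 0}} [L.Structure ℕ]

variable (L) in
/-- The predicate `P` on valuations of the variables `x₀, x₁, …` is expressed by a formula. The
valuation has an entry for every natural number, so that one type serves for all arities. Binding
`x₀` and lowering the other indices by one (de Bruijn indices) is how quantifiers act; see
`DefPred.ex`. -/
def DefPred (P : (ℕ → ℕ) → Prop) : Prop :=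
  ∃ φ : L.Formula ℕ, ∀ v : ℕ → ℕ, φ.Realize v ↔ P v

variable (L) in
/-- The function `f` of a valuation is definable: its graph is, with `x₀` for the value and
`x₁, x₂, …` for the arguments. -/
def DefFun (f : (ℕ → ℕ) → ℕ) : Prop :=
  DefPred L fun v => v 0 = f fun i => v (i + 1)

namespace DefPred

theorem congr {P Q : (ℕ → ℕ) → Prop} (hP : DefPred L P) (h : ∀ v, P v ↔ Q v) : DefPred L Q := by
  rwa [show Q = P from funext fun v => propext (h v).symm]

theorem not {P : (ℕ → ℕ) → Prop} (hP : DefPred L P) : DefPred L fun v => ¬ P v := by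
  obtain ⟨φ, hφ⟩ := hP
  exact ⟨φ.not, fun v => by rw [Formula.realize_not, hφ]⟩

theorem imp {P Q : (ℕ → ℕ) → Prop} (hP : DefPred L P) (hQ : DefPred L Q) :
    DefPred L fun v => P v → Q v := by
  obtain ⟨φ, hφ⟩ := hP
  obtain ⟨ψ, hψ⟩ := hQ
  exact ⟨φ.imp ψ, fun v => by rw [Formula.realize_imp, hφ, hψ]⟩

theorem and {P Q : (ℕ → ℕ) → Prop} (hP : DefPred L P) (hQ : DefPred L Q) :
    DefPred L fun v => P v ∧ Q v :=
  (hP.imp hQ.not).not.congr fun v => by tauto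

theorem or {P Q : (ℕ → ℕ) → Prop} (hP : DefPred L P) (hQ : DefPred L Q) :
    DefPred L fun v => P v ∨ Q v :=
  (hP.not.imp hQ).congr fun v => by tauto

theorem all {P : (ℕ → ℕ) → ℕ → Prop} (hP : DefPred L fun v => P (fun i => v (i + 1)) (v 0)) :
    DefPred L fun v => ∀ x, P v x := by
  obtain ⟨φ, hφ⟩ := hP
  let g : ℕ → ℕ ⊕ Fin 1 := fun i => Nat.casesOn i (Sum.inr 0) Sum.inl
  refine ⟨(BoundedFormula.relabel g φ).all, fun v => forall_congr' fun x => ?_⟩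
  rw [BoundedFormula.realize_relabel]
  have h : φ.Realize (fun i => (Nat.casesOn i x v : ℕ)) ↔ P v x := hφ _
  rw [← h, Formula.Realize, iff_eq_eq]
  congr 1
  · funext i
    cases i <;> rfl
  · exact Subsingleton.elim _ _

theorem ex {P : (ℕ → ℕ) → ℕ → Prop} (hP : DefPred L fun v => P (fun i => v (i + 1)) (v 0)) :
    DefPred L fun v => ∃ x, P v x :=
  (DefPred.all (P := fun v x => ¬ P v x) hP.not).not.congr fun v => by simp

/-- The variables of a definable predicate may be renamed, and identified. -/
theorem reindex {P : (ℕ → ℕ) → Prop} (hP : DefPred L P) (σ : ℕ → ℕ) :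
    DefPred L fun v => P fun i => v (σ i) := by
  obtain ⟨φ, hφ⟩ := hP
  exact ⟨φ.relabel σ, fun v => by rw [Formula.realize_relabel, hφ]; rfl⟩

theorem eq {f g : (ℕ → ℕ) → ℕ} (hf : DefFun L f) (hg : DefFun L g) :
    DefPred L fun v => f v = g v :=
  (DefPred.ex (P := fun v x => x = f v ∧ x = g v) (.and hf hg)).congr fun v => by simp

theorem comp₂ {R : ℕ → ℕ → Prop} (hR : DefPred L fun v => R (v 0) (v 1)) {f g : (ℕ → ℕ) → ℕ}
    (hf : DefFun L f) (hg : DefFun L g) : DefPred L fun v => R (f v) (g v) := by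
  -- Under the two quantifiers `y` is variable `0` and `x` is variable `1`; the others move up by `2`.
  have h : DefPred L fun v => ∃ x y, x = f v ∧ y = g v ∧ R x y :=
    .ex <| .ex <| .and (hf.reindex fun i => i.casesOn 1 fun j => j + 2) <|
      .and (hg.reindex fun i => i.casesOn 0 fun j => j + 2) <|
        hR.reindex fun i => i.casesOn 1 fun _ => 0
  exact h.congr fun v => by simp

theorem mem {F : ℕ →. ℕ} (hF : DefPred L fun v => v 0 ∈ F (v 1)) {f g : (ℕ → ℕ) → ℕ}
    (hf : DefFun L f) (hg : DefFun L g) : DefPred L fun v => f v ∈ F (g v) :=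
  .comp₂ (R := fun y x => y ∈ F x) hF hf hg

end DefPred

namespace DefFun

theorem var (i : ℕ) : DefFun L fun v => v i :=
  ⟨Term.equal (.var 0) (.var (i + 1)), fun v => by simp⟩

theorem comp₂ {F : ℕ → ℕ → ℕ} (hF : DefFun L fun v => F (v 0) (v 1)) {f g : (ℕ → ℕ) → ℕ}
    (hf : DefFun L f) (hg : DefFun L g) : DefFun L fun v => F (f v) (g v) := by
  -- Variable `0` of the context, the value of the function, becomes variable `2` of the body.
  have h : DefPred L fun v => ∃ x y, x = f (fun i => v (i + 1)) ∧ y = g (fun i => v (i + 1)) ∧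
      v 0 = F x y :=
    .ex <| .ex <| .and (hf.reindex fun i => i.casesOn 1 fun j => j + 3) <|
      .and (hg.reindex fun i => i.casesOn 0 fun j => j + 3) <|
        hF.reindex fun i => i.casesOn 2 fun j => j.casesOn 1 fun _ => 0
  exact h.congr fun v => by simp

end DefFun

end Definability

/-! ### Addition and multiplication from order and divisibility -/

/-- `y` is the next multiple of `d` after `n`. -/
def IsNextMultiple (d n y : ℕ) : Prop :=
  n < y ∧ d ∣ y ∧ ∀ z, n < z → d ∣ z → y ≤ z

theorem isNextMultiple_iff {d n y : ℕ} (hd : 0 < d) (hn : d ∣ n) :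
    IsNextMultiple d n y ↔ y = n + d := by
  have key : ∀ z, n < z → d ∣ z → n + d ≤ z := fun z hz hdz => by
    have := Nat.le_of_dvd (by omega) (Nat.dvd_sub hdz hn)
    omega
  have hdn : d ∣ n + d := hn.add (dvd_refl d)
  constructor
  · rintro ⟨h1, h2, h3⟩
    exact le_antisymm (h3 _ (by omega) hdn) (key y h1 h2)
  · rintro rfl
    exact ⟨by omega, hdn, key⟩

/-- A common multiple `n` of `x` and `x + y` for which `n + x` is a multiple of `y`. -/
theorem exists_dvd_add {x y : ℕ} (hx : 0 < x) (hy : 0 < y) :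
    ∃ n, x ∣ n ∧ x + y ∣ n ∧ y ∣ n + x := by
  obtain ⟨g, a, b, hg, hab, rfl, rfl⟩ := Nat.exists_coprime' (Nat.gcd_pos_of_pos_left y hx)
  -- `t` solves `a * t + 1 ≡ 0` modulo `b`, and then `n = g * a * (a + b) * t`.
  obtain ⟨t, ht⟩ : ∃ t, b ∣ a * t + 1 := by
    have hb : 0 < b := Nat.pos_of_mul_pos_right hy
    obtain ⟨t, -, ht⟩ := Nat.exists_mul_mod_eq_of_coprime (b - 1) hab (by omega)
    have h : a * t + 1 ≡ b - 1 + 1 [MOD b] := Nat.ModEq.add_right 1 ht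
    rw [Nat.sub_add_cancel hb] at h
    exact ⟨t, (h.dvd_iff dvd_rfl).2 dvd_rfl⟩
  refine ⟨g * a * (a + b) * t, ⟨(a + b) * t, by ring⟩, ⟨a * t, by ring⟩, ?_⟩
  rw [show g * a * (a + b) * t + a * g = (b * (a * t) + a * (a * t + 1)) * g by ring]
  exact mul_dvd_mul_right (((dvd_mul_right _ _)).add (ht.mul_left _)) _

/-- Addition in terms of order and divisibility: from a multiple `n` of both `x` and `z`, the step
to the next multiple of `x` and then to the next multiple of `y` is the step to the next multiple
of `z`. -/
theorem eq_add_iff {x y z : ℕ} (hx : 0 < x) (hy : 0 < y) :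
    z = x + y ↔ 0 < z ∧ ∃ n m k, x ∣ n ∧ z ∣ n ∧ y ∣ m ∧ IsNextMultiple x n m ∧
      IsNextMultiple y m k ∧ IsNextMultiple z n k := by
  constructor
  · rintro rfl
    obtain ⟨n, h1, h2, h3⟩ := exists_dvd_add hx hy
    exact ⟨by omega, n, n + x, n + x + y, h1, h2, h3, (isNextMultiple_iff hx h1).2 rfl,
      (isNextMultiple_iff hy h3).2 rfl, (isNextMultiple_iff (by omega) h2).2 (by ring)⟩
  · rintro ⟨hz, n, m, k, h1, h2, h3, h4, h5, h6⟩
    rw [isNextMultiple_iff hx h1] at h4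
    rw [isNextMultiple_iff hy h3] at h5
    rw [isNextMultiple_iff hz h2] at h6
    omega

/-- The square of `x` in terms of addition and divisibility, because `x * (x + 1)` is the least
common multiple of `x` and `x + 1`. -/
theorem eq_sq_iff {x s : ℕ} :
    s = x * x ↔ x ∣ x + s ∧ x + 1 ∣ x + s ∧ ∀ k, x ∣ k → x + 1 ∣ k → x + s ∣ k := by
  have hc : Nat.Coprime x (x + 1) := by simp
  have key : x + x * x = x * (x + 1) := by ring
  constructor
  · rintro rfl
    rw [key]
    exact ⟨dvd_mul_right _ _, dvd_mul_left _ _, fun k h1 h2 => hc.mul_dvd_of_dvd_of_dvd h1 h2⟩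
  · rintro ⟨h1, h2, h3⟩
    have := Nat.dvd_antisymm (h3 _ (dvd_mul_right _ _) (dvd_mul_left _ _))
      (hc.mul_dvd_of_dvd_of_dvd h1 h2)
    omega

/-- Order and divisibility of natural numbers are definable. -/
class DefinesOrderDvd (L : FirstOrder.Language.{0, 0}) [L.Structure ℕ] : Prop where
  defPred_lt : DefPred L fun v => v 0 < v 1
  defPred_dvd : DefPred L fun v => v 0 ∣ v 1

section Arithmetic

variable {L : FirstOrder.Language.{0, 0}} [L.Structure ℕ] [DefinesOrderDvd L]

theorem DefPred.lt {f g : (ℕ → ℕ) → ℕ} (hf : DefFun L f) (hg : DefFun L g) :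
    DefPred L fun v => f v < g v :=
  .comp₂ DefinesOrderDvd.defPred_lt hf hg

theorem DefPred.le {f g : (ℕ → ℕ) → ℕ} (hf : DefFun L f) (hg : DefFun L g) :
    DefPred L fun v => f v ≤ g v :=
  (DefPred.lt hg hf).not.congr fun _ => not_lt

theorem DefPred.dvd {f g : (ℕ → ℕ) → ℕ} (hf : DefFun L f) (hg : DefFun L g) :
    DefPred L fun v => f v ∣ g v :=
  .comp₂ DefinesOrderDvd.defPred_dvd hf hg

theorem DefFun.zero : DefFun L fun _ => 0 := by
  have h : DefPred L fun v => ∀ x, v 0 ≤ x := .all (.le (.var 1) (.var 0))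
  exact h.congr fun v => ⟨fun h => Nat.le_zero.1 (h 0), fun h => h ▸ Nat.zero_le⟩

theorem DefFun.succ {f : (ℕ → ℕ) → ℕ} (hf : DefFun L f) : DefFun L fun v => f v + 1 := by
  have h : DefFun L fun v => v 0 + 1 := by
    have h : DefPred L fun v => v 1 < v 0 ∧ ∀ x, v 1 < x → v 0 ≤ x :=
      .and (.lt (.var 1) (.var 0)) (.all (.imp (.lt (.var 2) (.var 0)) (.le (.var 1) (.var 0))))
    refine h.congr fun v => ?_
    show _ ↔ v 0 = v 1 + 1
    exact ⟨fun h => le_antisymm (h.2 _ (Nat.lt_succ_self _)) h.1,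
      fun h => ⟨by omega, fun x hx => by omega⟩⟩
  exact .comp₂ (F := fun x _ => x + 1) h hf hf

theorem DefPred.isNextMultiple (i j k : ℕ) :
    DefPred L fun v => IsNextMultiple (v i) (v j) (v k) :=
  .and (.lt (.var j) (.var k)) <| .and (.dvd (.var i) (.var k)) <|
    .all <| .imp (.lt (.var (j + 1)) (.var 0)) <| .imp (.dvd (.var (i + 1)) (.var 0)) <|
      .le (.var (k + 1)) (.var 0)

theorem DefFun.add {f g : (ℕ → ℕ) → ℕ} (hf : DefFun L f) (hg : DefFun L g) :
    DefFun L fun v => f v + g v := by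
  refine .comp₂ ?_ hf hg
  have h : DefPred L fun v => (v 1 = 0 ∧ v 0 = v 2) ∨ (v 2 = 0 ∧ v 0 = v 1) ∨
      (0 < v 1 ∧ 0 < v 2 ∧ 0 < v 0 ∧ ∃ n m k, v 1 ∣ n ∧ v 0 ∣ n ∧ v 2 ∣ m ∧
        IsNextMultiple (v 1) n m ∧ IsNextMultiple (v 2) m k ∧ IsNextMultiple (v 0) n k) :=
    .or (.and (.eq (.var 1) .zero) (.eq (.var 0) (.var 2))) <|
    .or (.and (.eq (.var 2) .zero) (.eq (.var 0) (.var 1))) <|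
    .and (.lt .zero (.var 1)) <| .and (.lt .zero (.var 2)) <| .and (.lt .zero (.var 0)) <|
    .ex <| .ex <| .ex <| .and (.dvd (.var 4) (.var 2)) <| .and (.dvd (.var 3) (.var 2)) <|
    .and (.dvd (.var 5) (.var 1)) <| .and (.isNextMultiple 4 2 1) <|
    .and (.isNextMultiple 5 1 0) (.isNextMultiple 3 2 0)
  refine h.congr fun v => ?_
  show _ ↔ v 0 = v 1 + v 2
  rcases Nat.eq_zero_or_pos (v 1) with h1 | h1
  · simp only [h1, lt_irrefl, false_and, or_false, true_and, zero_add]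
    omega
  rcases Nat.eq_zero_or_pos (v 2) with h2 | h2
  · simp only [h2, lt_irrefl, false_and, and_false, or_false, true_and, add_zero]
    omega
  rw [eq_add_iff h1 h2]
  simp [h1, h2, h1.ne', h2.ne']

theorem DefFun.sq {f : (ℕ → ℕ) → ℕ} (hf : DefFun L f) : DefFun L fun v => f v * f v := by
  have h : DefPred L fun v => v 1 ∣ v 1 + v 0 ∧ v 1 + 1 ∣ v 1 + v 0 ∧
      ∀ k, v 1 ∣ k → v 1 + 1 ∣ k → v 1 + v 0 ∣ k :=
    .and (.dvd (.var 1) (.add (.var 1) (.var 0))) <|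
    .and (.dvd (.succ (.var 1)) (.add (.var 1) (.var 0))) <|
    .all <| .imp (.dvd (.var 2) (.var 0)) <| .imp (.dvd (.succ (.var 2)) (.var 0)) <|
    .dvd (.add (.var 2) (.var 1)) (.var 0)
  exact .comp₂ (F := fun x _ => x * x) (h.congr fun v => eq_sq_iff.symm) hf hf

theorem DefFun.mul {f g : (ℕ → ℕ) → ℕ} (hf : DefFun L f) (hg : DefFun L g) :
    DefFun L fun v => f v * g v := by
  refine .comp₂ ?_ hf hg
  have h : DefPred L fun v => v 0 + v 0 + (v 1 * v 1 + v 2 * v 2) = (v 1 + v 2) * (v 1 + v 2) :=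
    .eq (.add (.add (.var 0) (.var 0)) (.add (.sq (.var 1)) (.sq (.var 2))))
      (.sq (.add (.var 1) (.var 2)))
  refine h.congr fun v => ?_
  rw [show (v 1 + v 2) * (v 1 + v 2) = v 1 * v 2 + v 1 * v 2 + (v 1 * v 1 + v 2 * v 2) by ring]
  show _ ↔ v 0 = v 1 * v 2
  omega

/-! ### Definability of the graphs of partial recursive functions -/

theorem DefFun.pair {f g : (ℕ → ℕ) → ℕ} (hf : DefFun L f) (hg : DefFun L g) :
    DefFun L fun v => Nat.pair (f v) (g v) := by
  refine .comp₂ ?_ hf hg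
  have h : DefPred L fun v => (v 1 < v 2 ∧ v 0 = v 2 * v 2 + v 1) ∨
      (¬ v 1 < v 2 ∧ v 0 = v 1 * v 1 + v 1 + v 2) :=
    .or (.and (.lt (.var 1) (.var 2)) (.eq (.var 0) (.add (.mul (.var 2) (.var 2)) (.var 1)))) <|
    .and (.not (.lt (.var 1) (.var 2)))
      (.eq (.var 0) (.add (.add (.mul (.var 1) (.var 1)) (.var 1)) (.var 2)))
  refine h.congr fun v => ?_
  show _ ↔ v 0 = Nat.pair (v 1) (v 2)
  rw [Nat.pair]
  split_ifs with hlt <;> simp [hlt]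

theorem DefFun.beta {f g : (ℕ → ℕ) → ℕ} (hf : DefFun L f) (hg : DefFun L g) :
    DefFun L fun v => Nat.beta (f v) (g v) := by
  refine .comp₂ ?_ hf hg
  have h : DefPred L fun v => ∃ a b q, v 1 = Nat.pair a b ∧ v 0 < (v 2 + 1) * b + 1 ∧
      a = ((v 2 + 1) * b + 1) * q + v 0 :=
    .ex <| .ex <| .ex <| .and (.eq (.var 4) (.pair (.var 2) (.var 1))) <|
    .and (.lt (.var 3) (.succ (.mul (.succ (.var 5)) (.var 1))))
      (.eq (.var 2) (.add (.mul (.succ (.mul (.succ (.var 5)) (.var 1))) (.var 0)) (.var 3)))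
  refine h.congr fun v => ?_
  show _ ↔ v 0 = Nat.beta (v 1) (v 2)
  rw [Nat.beta]
  constructor
  · rintro ⟨a, b, q, h1, h2, h3⟩
    rw [h1, Nat.unpair_pair]
    dsimp only
    rw [h3, Nat.mul_add_mod, Nat.mod_eq_of_lt h2]
  · intro h
    exact ⟨_, _, _, (Nat.pair_unpair _).symm, h ▸ Nat.mod_lt _ (Nat.succ_pos _), by
      rw [h]; exact (Nat.div_add_mod _ _).symm⟩

/-- Every finite sequence of natural numbers is a section of Gödel's `β` function. -/
theorem exists_beta_eq (s : ℕ → ℕ) (n : ℕ) : ∃ c, ∀ i ≤ n, Nat.beta c i = s i := by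
  let l := (List.range (n + 1)).map s
  refine ⟨Nat.unbeta l, fun i hi => ?_⟩
  have hl : i < l.length := by simp [l]; omega
  simpa [l] using Nat.beta_unbeta_coe l ⟨i, hl⟩

/-- A value of a recursion is witnessed by a code of the sequence of its intermediate values. -/
theorem mem_rec_iff {p : Part ℕ} {q : ℕ → ℕ → Part ℕ} {n m : ℕ} :
    m ∈ (Nat.rec p (fun y IH => IH.bind (q y)) n : Part ℕ) ↔
      ∃ c, Nat.beta c 0 ∈ p ∧ (∀ y, y < n → Nat.beta c (y + 1) ∈ q y (Nat.beta c y)) ∧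
        m = Nat.beta c n := by
  constructor
  · intro h
    obtain ⟨s, h0, hs, hm⟩ : ∃ s : ℕ → ℕ, s 0 ∈ p ∧ (∀ y < n, s (y + 1) ∈ q y (s y)) ∧ m = s n := by
      induction n generalizing m with
      | zero => exact ⟨fun _ => m, h, by simp, rfl⟩
      | succ n ih =>
        obtain ⟨k, hk, hm⟩ := Part.mem_bind_iff.1 h
        obtain ⟨s, h0, hs, rfl⟩ := ih hk
        refine ⟨Function.update s (n + 1) m, by simpa using h0, fun y hy => ?_, by simp⟩
        rcases Nat.lt_succ_iff_lt_or_eq.1 hy with hy | rfl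
        · rw [Function.update_of_ne (by omega), Function.update_of_ne (by omega)]
          exact hs y hy
        · rw [Function.update_self, Function.update_of_ne (by omega)]
          exact hm
    obtain ⟨c, hc⟩ := exists_beta_eq s n
    refine ⟨c, by rwa [hc 0 (by omega)], fun y hy => ?_, by rw [hc n le_rfl, hm]⟩
    rw [hc _ (by omega), hc _ (by omega)]
    exact hs y hy
  · rintro ⟨c, h0, hs, rfl⟩
    induction n with
    | zero => exact h0
    | succ n ih =>
      exact Part.mem_bind_iff.2 ⟨_, ih fun y hy => hs y (by omega), hs n (by omega)⟩

/-- The graph of a partial recursive function is definable, by induction on the function; recursion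
is unfolded with the `β` function. -/
theorem defPred_mem_partrec {f : ℕ →. ℕ} (hf : Nat.Partrec f) :
    DefPred L fun v => v 0 ∈ f (v 1) := by
  induction hf with
  | zero =>
    exact (DefPred.eq (.var 0) .zero).congr fun v => Part.mem_some_iff.symm
  | succ =>
    exact (DefPred.eq (.var 0) (.succ (.var 1))).congr fun v => Part.mem_some_iff.symm
  | left =>
    have h : DefPred L fun v => ∃ b, v 1 = Nat.pair (v 0) b :=
      .ex (.eq (.var 2) (.pair (.var 1) (.var 0)))
    refine h.congr fun v => ?_
    rw [PFun.coe_val, Part.mem_some_iff]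
    exact ⟨fun ⟨b, hb⟩ => by simp [hb], fun h => ⟨_, by rw [h, Nat.pair_unpair]⟩⟩
  | right =>
    have h : DefPred L fun v => ∃ a, v 1 = Nat.pair a (v 0) :=
      .ex (.eq (.var 2) (.pair (.var 0) (.var 1)))
    refine h.congr fun v => ?_
    rw [PFun.coe_val, Part.mem_some_iff]
    exact ⟨fun ⟨b, hb⟩ => by simp [hb], fun h => ⟨_, by rw [h, Nat.pair_unpair]⟩⟩
  | @pair f g _ _ hf hg =>
    have h : DefPred L fun v => ∃ a b, a ∈ f (v 1) ∧ b ∈ g (v 1) ∧ v 0 = Nat.pair a b :=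
      .ex <| .ex <| .and (.mem hf (.var 1) (.var 3)) <| .and (.mem hg (.var 0) (.var 3)) <|
        .eq (.var 2) (.pair (.var 1) (.var 0))
    exact h.congr fun v => by simp [Seq.seq, eq_comm]
  | @comp f g _ _ hf hg =>
    have h : DefPred L fun v => ∃ a, a ∈ g (v 1) ∧ v 0 ∈ f a :=
      .ex <| .and (.mem hg (.var 0) (.var 2)) (.mem hf (.var 1) (.var 0))
    exact h.congr fun v => Part.mem_bind_iff.symm
  | @prec f g _ _ hf hg =>
    have h : DefPred L fun v => ∃ a n, v 1 = Nat.pair a n ∧ ∃ c, Nat.beta c 0 ∈ f a ∧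
        (∀ y, y < n → Nat.beta c (y + 1) ∈ g (Nat.pair a (Nat.pair y (Nat.beta c y)))) ∧
        v 0 = Nat.beta c n :=
      .ex <| .ex <| .and (.eq (.var 3) (.pair (.var 1) (.var 0))) <| .ex <|
        .and (.mem hf (.beta (.var 0) .zero) (.var 2)) <|
        .and (.all <| .imp (.lt (.var 0) (.var 2)) <| .mem hg (.beta (.var 1) (.succ (.var 0))) <|
          .pair (.var 3) (.pair (.var 0) (.beta (.var 1) (.var 0)))) <|
        .eq (.var 3) (.beta (.var 0) (.var 1))
    refine h.congr fun v => ?_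
    constructor
    · rintro ⟨a, n, hv, h⟩
      rw [hv, Nat.unpaired, Nat.unpair_pair]
      exact mem_rec_iff.2 h
    · exact fun h => ⟨_, _, (Nat.pair_unpair _).symm, mem_rec_iff.1 h⟩
  | @rfind f _ hf =>
    have h : DefPred L fun v => 0 ∈ f (Nat.pair (v 1) (v 0)) ∧
        ∀ k, k < v 0 → ∃ m, m ∈ f (Nat.pair (v 1) k) ∧ ¬ m = 0 :=
      .and (.mem hf .zero (.pair (.var 1) (.var 0))) <| .all <|
        .imp (.lt (.var 0) (.var 1)) <| .ex <|
        .and (.mem hf (.var 0) (.pair (.var 3) (.var 1))) <| .not (.eq (.var 0) .zero)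
    refine h.congr fun v => ?_
    exact Iff.trans (by simp) Nat.mem_rfind.symm

end Arithmetic

/-! ### Sentences expressing membership of a given number in a definable set -/

/-- The term `s # t`. -/
def opTerm {α : Type} (s t : opLang.Term α) : opLang.Term α :=
  .func OpFunctions.op ![s, t]

/-- A formula expressing `t = 0`, namely `t # t = t`. -/
def zeroFormula {n : ℕ} (t : opLang.Term (Empty ⊕ Fin n)) : opLang.BoundedFormula Empty n :=
  .equal (opTerm t t) t

/-- A quantifier-free formula expressing `s < t`, namely `t ≠ 0 ∧ (s ≠ 0 → s # t = s)`. -/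
def ltFormula {n : ℕ} (s t : opLang.Term (Empty ⊕ Fin n)) : opLang.BoundedFormula Empty n :=
  .imp (.imp (.imp (zeroFormula t) .falsum)
    (.imp (.imp (.imp (zeroFormula s) .falsum) (.equal (opTerm s t) s)) .falsum)) .falsum

/-- A formula with last free variable `xₖ` that expresses `j ≤ xₖ`, by saying that there is a
descending chain `xₖ > xₖ₊₁ > ⋯ > xₖ₊ⱼ`. The chain stands in for a numeral: the language has no
closed terms, and each link refers only to the two most recently bound variables. -/
def geFormula : ℕ → (k : ℕ) → opLang.BoundedFormula Empty (k + 1)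
  | 0, _ => .imp .falsum .falsum
  | j + 1, k => .imp (.all (.imp
      (ltFormula (.var (.inr (Fin.last (k + 1)))) (.var (.inr (Fin.last k).castSucc)))
      (.imp (geFormula j (k + 1)) .falsum))) .falsum

/-- The sentence `∃ x₀, A ∧ n ≤ x₀ ∧ ¬ n + 1 ≤ x₀`, saying that `n` satisfies the formula `A`. It is
written as `¬ ∀ x₀, A → n ≤ x₀ → n + 1 ≤ x₀`. -/
def memSentence (A : opLang.BoundedFormula Empty 1) (n : ℕ) : opLang.Sentence :=
  .imp (.all (.imp A (.imp (geFormula n 0) (geFormula (n + 1) 0)))) .falsum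

/-- The Gödel number of the term `s # t` in terms of those of `s` and `t`. -/
def opCode (s t : ℕ) : ℕ := 2 * Nat.pair s t + 1

/-- The Gödel number of an equation in terms of those of its two sides. -/
def eqCode (s t : ℕ) : ℕ := 3 * Nat.pair s t + 1

/-- The Gödel number of an implication in terms of those of its two sides. -/
def impCode (a b : ℕ) : ℕ := 3 * Nat.pair a b + 2

/-- The Gödel number of a universally quantified formula in terms of the one of its matrix. -/
def allCode (a : ℕ) : ℕ := 3 * a + 3

/-- The Gödel number of `ltFormula s t` in terms of those of `s` and `t`. -/
def ltCode (s t : ℕ) : ℕ :=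
  impCode (impCode (impCode (eqCode (opCode t t) t) 0) (impCode
    (impCode (impCode (eqCode (opCode s s) s) 0) (eqCode (opCode s t) s)) 0)) 0

/-- The Gödel number of `geFormula j (m - j)`. With the sum `m` of the two arguments fixed, the
recursion defining `geFormula` is a primitive recursion. -/
def geCode (m : ℕ) : ℕ → ℕ
  | 0 => impCode 0 0
  | j + 1 => impCode (allCode (impCode (ltCode (2 * (m - j)) (2 * (m - (j + 1))))
      (impCode (geCode m j) 0))) 0

theorem formulaCode_imp {n : ℕ} (φ ψ : opLang.BoundedFormula Empty n) :
    formulaCode (.imp φ ψ) = impCode (formulaCode φ) (formulaCode ψ) := rfl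

theorem formulaCode_all {n : ℕ} (φ : opLang.BoundedFormula Empty (n + 1)) :
    formulaCode (.all φ) = allCode (formulaCode φ) := rfl

theorem formulaCode_ltFormula {n : ℕ} (s t : opLang.Term (Empty ⊕ Fin n)) :
    formulaCode (ltFormula s t) = ltCode (termCode s) (termCode t) := rfl

theorem formulaCode_geFormula (j k : ℕ) : formulaCode (geFormula j k) = geCode (j + k) j := by
  induction j generalizing k with
  | zero => rfl
  | succ j ih =>
    have h : j + 1 + k - (j + 1) = k := by omega
    have h' : j + 1 + k - j = k + 1 := by omega
    have h'' : j + (k + 1) = j + 1 + k := by omega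
    rw [geFormula, geCode, formulaCode_imp, formulaCode_all, formulaCode_imp, formulaCode_imp,
      formulaCode_ltFormula, ih, h, h', h'']
    rfl

section Primrec

variable {α : Type} [Primcodable α] {f g : α → ℕ}

theorem primrec_opCode (hf : Primrec f) (hg : Primrec g) : Primrec fun a => opCode (f a) (g a) :=
  Primrec.nat_double_succ.comp (Primrec₂.natPair.comp hf hg)

theorem primrec_impCode (hf : Primrec f) (hg : Primrec g) : Primrec fun a => impCode (f a) (g a) :=
  Primrec.nat_add.comp
    (Primrec.nat_mul.comp (Primrec.const 3) (Primrec₂.natPair.comp hf hg)) (Primrec.const 2)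

theorem primrec_eqCode (hf : Primrec f) (hg : Primrec g) : Primrec fun a => eqCode (f a) (g a) :=
  Primrec.nat_add.comp
    (Primrec.nat_mul.comp (Primrec.const 3) (Primrec₂.natPair.comp hf hg)) (Primrec.const 1)

theorem primrec_allCode (hf : Primrec f) : Primrec fun a => allCode (f a) :=
  Primrec.nat_add.comp (Primrec.nat_mul.comp (Primrec.const 3) hf) (Primrec.const 3)

theorem primrec_ltCode (hf : Primrec f) (hg : Primrec g) : Primrec fun a => ltCode (f a) (g a) :=
  have neg {h : α → ℕ} (hh : Primrec h) : Primrec fun a => impCode (h a) 0 :=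
    primrec_impCode hh (.const 0)
  neg <| primrec_impCode (neg <| primrec_eqCode (primrec_opCode hg hg) hg) <| neg <|
    primrec_impCode (neg <| primrec_eqCode (primrec_opCode hf hf) hf) <|
      primrec_eqCode (primrec_opCode hf hg) hf

end Primrec

theorem primrec₂_geCode : Primrec₂ geCode := by
  have sub {f g : ℕ × ℕ × ℕ → ℕ} (hf : Primrec f) (hg : Primrec g) :
      Primrec fun p => 2 * (f p - g p) :=
    Primrec.nat_mul.comp (.const 2) (Primrec.nat_sub.comp hf hg)
  have hj : Primrec fun p : ℕ × ℕ × ℕ => p.2.1 := Primrec.fst.comp .snd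
  have h : Primrec₂ fun (m : ℕ) (p : ℕ × ℕ) =>
      impCode (allCode (impCode (ltCode (2 * (m - p.1)) (2 * (m - (p.1 + 1))))
        (impCode p.2 0))) 0 :=
    primrec_impCode (primrec_allCode <| primrec_impCode
      (primrec_ltCode (sub .fst hj) (sub .fst (Primrec.succ.comp hj)))
      (primrec_impCode (Primrec.snd.comp .snd) (.const 0))) (.const 0)
  refine (Primrec.nat_rec (Primrec.const (impCode 0 0)) h).of_eq fun m j => ?_
  induction j with
  | zero => rfl
  | succ j ih => rw [geCode, ← ih]

/-- The sentences `memSentence A n` are effectively given: this makes `n ↦ memSentence A n` a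
many-one reduction. -/
theorem primrec_formulaCode_memSentence (A : opLang.BoundedFormula Empty 1) :
    Primrec fun n => formulaCode (memSentence A n) := by
  have hge : Primrec fun n => geCode n n := primrec₂_geCode.comp .id .id
  have h : Primrec fun n => impCode (allCode (impCode (formulaCode A)
      (impCode (geCode n n) (geCode (n + 1) (n + 1))))) 0 :=
    primrec_impCode (primrec_allCode <| primrec_impCode (.const _) <|
      primrec_impCode hge (hge.comp Primrec.succ)) (.const 0)
  refine h.of_eq fun n => ?_
  rw [memSentence, formulaCode_imp, formulaCode_all, formulaCode_imp, formulaCode_imp,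
    formulaCode_geFormula, formulaCode_geFormula]
  rfl

/-! ### The reduction of the halting problem -/

section Reduction

variable {op : ℕ → ℕ → ℕ}

theorem realize_opTerm (op : ℕ → ℕ → ℕ) {α : Type} (s t : opLang.Term α) (v : α → ℕ) :
    letI := opStructure op
    (opTerm s t).realize v = op (s.realize v) (t.realize v) := rfl

theorem defFun_op (op : ℕ → ℕ → ℕ) {f g : (ℕ → ℕ) → ℕ} :
    letI := opStructure op
    DefFun opLang f → DefFun opLang g → DefFun opLang fun v => op (f v) (g v) := by
  let _ := opStructure op
  refine fun hf hg => DefFun.comp₂ ?_ hf hg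
  refine ⟨Term.equal (.var 0) (opTerm (.var 1) (.var 2)), fun v => ?_⟩
  rw [Formula.realize_equal]
  rfl

theorem op_self_eq_self_iff (h_zero : ∀ x : ℕ, x = 0 ↔ ∃ y : ℕ, op y y = x) (x : ℕ) :
    op x x = x ↔ x = 0 := by
  rw [(h_zero _).2 ⟨x, rfl⟩, eq_comm]

theorem lt_iff_op (h_lt : ∀ x y : ℕ, x < y ↔ (x = 0 ∧ y ≠ 0) ∨ (x ≠ 0 ∧ y ≠ 0 ∧ op x y = x))
    (x y : ℕ) : x < y ↔ ¬ y = 0 ∧ (¬ x = 0 → op x y = x) := by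
  rw [h_lt]
  tauto

theorem definesOrderDvd_opStructure (h_zero : ∀ x : ℕ, x = 0 ↔ ∃ y : ℕ, op y y = x)
    (h_lt : ∀ x y : ℕ, x < y ↔ (x = 0 ∧ y ≠ 0) ∨ (x ≠ 0 ∧ y ≠ 0 ∧ op x y = x))
    (h_dvd : ∀ x y : ℕ, y ∣ x ↔ x = 0 ∨ (x ≠ 0 ∧ op x y = 0)) :
    @DefinesOrderDvd opLang (opStructure op) := by
  let _ := opStructure op
  have hz (i : ℕ) : DefPred opLang fun v => v i = 0 :=
    (DefPred.eq (defFun_op op (.var i) (.var i)) (.var i)).congr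
      fun v => op_self_eq_self_iff h_zero (v i)
  constructor
  · have h : DefPred opLang fun v => ¬ v 1 = 0 ∧ (¬ v 0 = 0 → op (v 0) (v 1) = v 0) :=
      .and (hz 1).not <| .imp (hz 0).not <| .eq (defFun_op op (.var 0) (.var 1)) (.var 0)
    exact h.congr fun v => (lt_iff_op h_lt _ _).symm
  · -- The value `0` of `op` is expressed through a variable `x` with `x = 0`.
    have h : DefPred opLang fun v => v 1 = 0 ∨ ∃ x, x = 0 ∧ op (v 1) (v 0) = x :=
      .or (hz 1) <| .ex <| .and (hz 0) <| .eq (defFun_op op (.var 2) (.var 1)) (.var 0)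
    refine h.congr fun v => ?_
    rw [h_dvd, exists_eq_left]
    tauto

theorem realize_ltFormula (h_zero : ∀ x : ℕ, x = 0 ↔ ∃ y : ℕ, op y y = x)
    (h_lt : ∀ x y : ℕ, x < y ↔ (x = 0 ∧ y ≠ 0) ∨ (x ≠ 0 ∧ y ≠ 0 ∧ op x y = x)) {n : ℕ}
    (s t : opLang.Term (Empty ⊕ Fin n)) (v : Empty → ℕ) (xs : Fin n → ℕ) :
    letI := opStructure op
    (ltFormula s t).Realize v xs ↔
      s.realize (Sum.elim v xs) < t.realize (Sum.elim v xs) := by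
  let _ := opStructure op
  simp only [ltFormula, zeroFormula, BoundedFormula.Realize, realize_opTerm,
    op_self_eq_self_iff h_zero, lt_iff_op h_lt]
  tauto

theorem realize_geFormula (h_zero : ∀ x : ℕ, x = 0 ↔ ∃ y : ℕ, op y y = x)
    (h_lt : ∀ x y : ℕ, x < y ↔ (x = 0 ∧ y ≠ 0) ∨ (x ≠ 0 ∧ y ≠ 0 ∧ op x y = x)) (j k : ℕ)
    (v : Empty → ℕ) (xs : Fin (k + 1) → ℕ) :
    letI := opStructure op
    (geFormula j k).Realize v xs ↔ j ≤ xs (Fin.last k) := by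
  let _ := opStructure op
  induction j generalizing k with
  | zero => simp [geFormula, BoundedFormula.Realize]
  | succ j ih =>
    simp only [geFormula, BoundedFormula.Realize, realize_ltFormula h_zero h_lt, ih,
      Term.realize_var, Sum.elim_inr, Fin.snoc_last, Fin.snoc_castSucc]
    constructor
    · intro h
      by_contra hj
      exact h fun a ha hja => hj (by omega)
    · exact fun h h' => h' j (by omega) le_rfl

/-- The sentence expresses what it is meant to: the chain formulas hold of `x₀` exactly when
`n ≤ x₀` and not `n + 1 ≤ x₀`, which pins `x₀` down to `n`. -/
theorem realize_memSentence (h_zero : ∀ x : ℕ, x = 0 ↔ ∃ y : ℕ, op y y = x)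
    (h_lt : ∀ x y : ℕ, x < y ↔ (x = 0 ∧ y ≠ 0) ∨ (x ≠ 0 ∧ y ≠ 0 ∧ op x y = x))
    (A : opLang.BoundedFormula Empty 1) (n : ℕ) :
    letI := opStructure op
    memSentence A n ∈ opTheory op ↔ A.Realize Empty.elim fun _ => n := by
  let _ := opStructure op
  have hv (a : ℕ) (v : Empty → ℕ) :
      A.Realize v (Fin.snoc default a) ↔ A.Realize Empty.elim fun _ => a := by
    rw [iff_eq_eq]
    congr 1
    exact Subsingleton.elim _ _
  rw [opTheory, mem_completeTheory, Sentence.Realize, Formula.Realize, memSentence]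
  simp only [BoundedFormula.Realize, realize_geFormula h_zero h_lt, Fin.snoc_last]
  constructor
  · intro h
    by_contra hA
    refine h fun a ha hna => ?_
    rcases Nat.lt_or_eq_of_le hna with hlt | rfl
    · exact hlt
    · exact absurd ((hv _ _).1 ha) hA
  · exact fun hA h => absurd (h n ((hv _ _).2 hA) le_rfl) (by omega)

/-- A definable set of natural numbers is defined by a formula in which `x₀` is the only free
variable. -/
theorem DefPred.exists_boundedFormula {K : ℕ → Prop} :
    letI := opStructure op
    DefPred opLang (fun v => K (v 0)) →
      ∃ A : opLang.BoundedFormula Empty 1, ∀ n, A.Realize Empty.elim (fun _ => n) ↔ K n := by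
  let _ := opStructure op
  rintro ⟨φ, hφ⟩
  refine ⟨BoundedFormula.relabel (fun _ => Sum.inr 0 : ℕ → Empty ⊕ Fin 1) φ, fun n => ?_⟩
  rw [BoundedFormula.realize_relabel]
  have h : φ.Realize (fun _ => n) ↔ K n := hφ _
  rw [← h, Formula.Realize, iff_eq_eq]
  congr 1
  exact Subsingleton.elim _ _

end Reduction

end HashTheory

theorem mainTheorem2 (op : ℕ → ℕ → ℕ)
    (h_zero : ∀ x : ℕ, x = 0 ↔ ∃ y : ℕ, op y y = x)
    (h_lt : ∀ x y : ℕ, x < y ↔ (x = 0 ∧ y ≠ 0) ∨ (x ≠ 0 ∧ y ≠ 0 ∧ op x y = x))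
    (h_dvd : ∀ x y : ℕ, y ∣ x ↔ x = 0 ∨ (x ≠ 0 ∧ op x y = 0)) :
    ¬ HashTheory.DecidableTheory (HashTheory.opTheory op) := by
  intro hdec
  let _ := HashTheory.opStructure op
  have := HashTheory.definesOrderDvd_opStructure h_zero h_lt h_dvd
  -- `F n` runs the program with number `n` on input `0`.
  let F : ℕ →. ℕ := fun n => (Denumerable.ofNat Nat.Partrec.Code n).eval 0
  have hF : Nat.Partrec F := Partrec.nat_iff.1 <|
    Nat.Partrec.Code.eval_part.comp (Computable.ofNat _) (Computable.const 0)
  have hK : HashTheory.DefPred HashTheory.opLang fun v => ∃ y, y ∈ F (v 0) :=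
    .ex <| .mem (HashTheory.defPred_mem_partrec hF) (.var 0) (.var 1)
  obtain ⟨A, hA⟩ := HashTheory.DefPred.exists_boundedFormula (K := fun n => ∃ y, y ∈ F n) hK
  refine ComputablePred.halting_problem 0 (ComputablePred.computable_of_manyOneReducible
    ⟨fun c => HashTheory.formulaCode (HashTheory.memSentence A (Encodable.encode c)),
      (HashTheory.primrec_formulaCode_memSentence A).to_comp.comp Computable.encode,
      fun c => ?_⟩ hdec)
  have h : (∃ φ ∈ HashTheory.opTheory op, HashTheory.formulaCode φ =
      HashTheory.formulaCode (HashTheory.memSentence A (Encodable.encode c))) ↔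
      HashTheory.memSentence A (Encodable.encode c) ∈ HashTheory.opTheory op :=
    ⟨fun ⟨φ, hφ, he⟩ => HashTheory.formulaCode_injective _ _ he ▸ hφ, fun h => ⟨_, h, rfl⟩⟩
  rw [h, HashTheory.realize_memSentence h_zero h_lt, hA, ← Part.dom_iff_mem]
  simp only [F, Denumerable.ofNat_encode]
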